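/- \textbf{Setting.} Let $(\Omega,\mathcal F,\mathbb P)$ be a probability space, $N\ge 1$ an integer, $[N]=\{1,\dots,N\}$, and let $\rho\colon L^\infty(\mathbb R)\to\mathbb R$ be a coherent risk measure that is continuous from above: $\rho(0)=0$; $\rho(Y^1)\le\rho(Y^2)$ if $Y^1\ge Y^2$ a.s.; $\rho(Y+c)=\rho(Y)-c$ for $c\in\mathbb R$; $\rho$ is convex and positively homogeneous; and $\rho(Y^n)\uparrow\rho(Y)$ whenever $Y^n\downarrow Y$ a.s. in $L^\infty(\mathbb R)$. Let $\mathcal A=\{Y\in L^\infty(\mathbb R): \rho(Y)\le 0\}$. For $f$ with values in $\mathbb R\cup\{-\infty\}$ put $\operatorname{dom} f=\{f>-\infty\}$. A rectangular upper set in $\mathbb R^N$ is $\emptyset$ or a product $A_1\times\dots\times A_N$ in which each $A_i$ is $\mathbb R$ or $[a_i,\infty)$ for some $a_i\in\mathbb R$. An \emph{aggregation function} is a function $\Lambda\colon\mathbb R^N\times\mathbb R^N\to\mathbb R\cup\{-\infty\}$ that is componentwise increasing and concave, has nonempty closed domain, is continuous relative to $\operatorname{dom}\Lambda$, and is such that all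 sections $\{x:(x,m)\in\operatorname{dom}\Lambda\}$ and $\{m:(x,m)\in\operatorname{dom}\Lambda\}$ are rectangular upper sets. A function $\bar\Lambda\colon\mathbb R^N\to\mathbb R\cup\{-\infty\}$ is a \emph{single-element aggregation function} if $(x,m)\mapsto\bar\Lambda(x)$ is an aggregation function. Write $(t,m_{-i})$ for the vector $m$ with its $i$-th entry replaced by $t$, and $e_i$ for the $i$-th unit vector. A \emph{decomposition} of an aggregation function $\Lambda$ is a family of aggregation functions $(\Lambda_i)_{i\in[N]}$ with $\Lambda=\sum_i\Lambda_i$ and $\operatorname{dom}\Lambda_i=\operatorname{dom}\Lambda$ for all $i$ such that for every $x\in\mathbb R^N$ for which $D(x)=\{m:(x,m)\in\operatorname{dom}\Lambda\}$ is nonempty there are $\bar r,\underline r\in D(x)$ with $\Lambda_i(x,(\bar r_i,m_{-i}))>0$ and $\Lambda_i(x,(\underline r_i-\varepsilon,m_{-i}))<0$ for all $m\in D(x)$, $i\in[N]$, $\varepsilon>0$. It is \emph{self-preferential with constant} $L\in[0,1)$ if $\Lambda_i(x,m+L\delta e_i)\ge\Lambda_i(x,m+\delta e_j)$ for all $i\ne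 j$, $(x,m)\in\operatorname{dom}\Lambda$, $\delta\ge0$. For $X\in L^\infty(\mathbb R^N)$ let $D(X)=\{m\in\mathbb R^N:(X,m)\in\operatorname{dom}\Lambda\text{ a.s.}\}$, and let $L^\infty_\Lambda(\mathbb R^N)=\{X: D(X)\neq\emptyset\}$. A \emph{Nash allocation rule} for $(\mathcal A,(\Lambda_i)_{i\in[N]})$ is a map $r\colon L^\infty_\Lambda(\mathbb R^N)\to\mathbb R^N$ such that for every $X\in L^\infty_\Lambda(\mathbb R^N)$ and $i\in[N]$ \[ r_i(X)=\inf\{t\in\mathbb R : (t,r_{-i}(X))\in D(X),\ \Lambda_i(X,(t,r_{-i}(X)))\in\mathcal A\}. \] \textbf{Statement.} Let $\bar\Lambda$ be a single-element aggregation function, and let $(\bar\Lambda_i)_{i\in[N]}$ be a single-element decomposition of it, that is, single-element aggregation functions with $\bar\Lambda=\sum_i\bar\Lambda_i$ and $\operatorname{dom}\bar\Lambda_i=\operatorname{dom}\bar\Lambda$ for all $i$. Suppose that (1) there is $\bar x\in\operatorname{dom}\bar\Lambda$ such that $\bar\Lambda_i(\bar x_i,x_{-i})>0$ for all $x\in\operatorname{dom}\bar\Lambda$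 and $i\in[N]$; (2) there is $\underline x\in\operatorname{dom}\bar\Lambda$ such that $-\infty\le\bar\Lambda_i(\underline x_i-\varepsilon,x_{-i})<0$ for all $x\in\operatorname{dom}\bar\Lambda$, $i\in[N]$ and $\varepsilon>0$. Put $\Lambda^S(x,m)=\bar\Lambda(x+m)$ and $\Lambda^S_i(x,m)=\bar\Lambda_i(x+m)$. Then $\Lambda^S$ is an aggregation function, $(\Lambda^S_i)_{i\in[N]}$ is a decomposition of it, $L^\infty_{\Lambda^S}(\mathbb R^N)=L^\infty(\mathbb R^N)$, and there exists a Nash allocation rule $r^S\colon L^\infty(\mathbb R^N)\to\mathbb R^N$ for $(\mathcal A,(\Lambda^S_i)_{i\in[N]})$. Moreover, if $L\in[0,1)$ is such that $\bar\Lambda_i(x+L\alpha e_i)\ge\bar\Lambda_i(x+\alpha e_j)$ for all $i\ne j$ in $[N]$, $x\in\operatorname{dom}\bar\Lambda$ and $\alpha\ge0$, then $(\Lambda^S_i)_{i\in[N]}$ is self-preferential with constant $L$; and if also $L<\frac1{N-1}$ (no condition when $N=1$), then the Nash allocation rule is unique. -/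

import Mathlib

open MeasureTheory Set Filter Topology

namespace SystemicRisk

/-! ### Functions with values in `ℝ ∪ {-∞}` and aggregation functions -/

/-- The effective domain `{a | f a > -∞}` of a function with values in `ℝ ∪ {-∞}`. -/
def effDom {α : Type*} (f : α → WithBot ℝ) : Set α := {a | f a ≠ ⊥}

/-- The real-valued function that agrees with `f` on its effective domain (and is `0` outside;
it is only ever used on the effective domain). -/
noncomputable def finitePart {α : Type*} (f : α → WithBot ℝ) (a : α) : ℝ := (f a).unbotD 0

/-- Rectangular upper sets of `ℝ^N`: the empty set, and the products `A₁ × ⋯ × A_N` where each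
`A_i` is either `ℝ` or a closed half-line `[a, ∞)`. -/
def IsRectUpper {N : ℕ} (A : Set (Fin N → ℝ)) : Prop :=
  A = ∅ ∨ ∃ S : Fin N → Set ℝ,
    (∀ i, S i = univ ∨ ∃ a : ℝ, S i = Ici a) ∧ A = Set.pi univ S

/-- Aggregation functions `Λ : ℝ^N × ℝ^N → ℝ ∪ {-∞}`, `(x, m) ↦ Λ (x, m)`, where `x` is a shock and
`m` is a capital vector; order and convexity on `ℝ^N × ℝ^N` are the componentwise ones. -/
structure IsAggregation {N : ℕ} (Λ : (Fin N → ℝ) × (Fin N → ℝ) → WithBot ℝ) : Prop where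
  monotone : Monotone Λ
  concave : ConcaveOn ℝ (effDom Λ) (finitePart Λ)
  nonempty_dom : (effDom Λ).Nonempty
  closed_dom : IsClosed (effDom Λ)
  continuous : ContinuousOn (finitePart Λ) (effDom Λ)
  rect_shock : ∀ m, IsRectUpper {x | (x, m) ∈ effDom Λ}
  rect_capital : ∀ x, IsRectUpper {m | (x, m) ∈ effDom Λ}

/-- Single-element aggregation functions: `(x, m) ↦ Λ x` is an aggregation function. -/
def IsSingleAggregation {N : ℕ} (Λ : (Fin N → ℝ) → WithBot ℝ) : Prop :=
  IsAggregation (fun p : (Fin N → ℝ) × (Fin N → ℝ) => Λ p.1)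

/-- A decomposition `(Λ_i)` of the aggregation function `Λ`: aggregation functions that sum to `Λ`,
share its domain, and are self-feasible and self-infeasible.
`Function.update m i t` is the vector `(t, m_{-i})`. -/
structure IsDecomposition {N : ℕ} (Λ : (Fin N → ℝ) × (Fin N → ℝ) → WithBot ℝ)
    (Λi : Fin N → (Fin N → ℝ) × (Fin N → ℝ) → WithBot ℝ) : Prop where
  aggregation : ∀ i, IsAggregation (Λi i)
  sum_eq : ∀ p, Λ p = ∑ i, Λi i p
  dom_eq : ∀ i, effDom (Λi i) = effDom Λ
  self_feasible : ∀ x : Fin N → ℝ, (∃ m, (x, m) ∈ effDom Λ) →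
    ∃ r, (x, r) ∈ effDom Λ ∧
      ∀ m, (x, m) ∈ effDom Λ → ∀ i, 0 < Λi i (x, Function.update m i (r i))
  self_infeasible : ∀ x : Fin N → ℝ, (∃ m, (x, m) ∈ effDom Λ) →
    ∃ r, (x, r) ∈ effDom Λ ∧
      ∀ m, (x, m) ∈ effDom Λ → ∀ i, ∀ ε : ℝ, 0 < ε →
        Λi i (x, Function.update m i (r i - ε)) < 0

/-- The family `(Λ_i)` (with common domain `effDom Λ`) is self-preferential with constant `L`. -/
def IsSelfPreferentialWith {N : ℕ} (Λ : (Fin N → ℝ) × (Fin N → ℝ) → WithBot ℝ)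
    (Λi : Fin N → (Fin N → ℝ) × (Fin N → ℝ) → WithBot ℝ) (L : ℝ) : Prop :=
  0 ≤ L ∧ L < 1 ∧
    ∀ i j, i ≠ j → ∀ x m, (x, m) ∈ effDom Λ → ∀ δ : ℝ, 0 ≤ δ →
      Λi i (x, m + Pi.single j δ) ≤ Λi i (x, m + Pi.single i (L * δ))

/-- A single-element decomposition: single-element aggregation functions that sum to `Λ` and
share its domain. -/
structure IsSingleDecomposition {N : ℕ} (Λ : (Fin N → ℝ) → WithBot ℝ)
    (Λi : Fin N → (Fin N → ℝ) → WithBot ℝ) : Prop where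
  aggregation : ∀ i, IsSingleAggregation (Λi i)
  sum_eq : ∀ x, Λ x = ∑ i, Λi i x
  dom_eq : ∀ i, effDom (Λi i) = effDom Λ

/-- The sensitive function `(x, m) ↦ Λ (x + m)`. -/
def sensitive {N : ℕ} (Λ : (Fin N → ℝ) → WithBot ℝ) :
    (Fin N → ℝ) × (Fin N → ℝ) → WithBot ℝ :=
  fun p => Λ (p.1 + p.2)

/-! ### Risk measures on `L^∞` -/

/-- Coherent risk measures `ρ : L^∞(ℝ) → ℝ` that are continuous from above. In the last field the
sequence `ρ (Y n)` is automatically increasing, by monotonicity. -/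
structure IsCoherentRiskMeasure {Ω : Type*} [MeasurableSpace Ω] {P : Measure Ω}
    [IsProbabilityMeasure P] (ρ : Lp ℝ ⊤ P → ℝ) : Prop where
  normalized : ρ 0 = 0
  monotone : ∀ Y₁ Y₂, Y₂ ≤ Y₁ → ρ Y₁ ≤ ρ Y₂
  translative : ∀ Y (c : ℝ), ρ (Y + Lp.const ⊤ P c) = ρ Y - c
  convex : ∀ Y₁ Y₂ (a : ℝ), 0 ≤ a → a ≤ 1 →
    ρ (a • Y₁ + (1 - a) • Y₂) ≤ a * ρ Y₁ + (1 - a) * ρ Y₂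
  pos_homogeneous : ∀ Y (a : ℝ), 0 ≤ a → ρ (a • Y) = a * ρ Y
  continuous_from_above : ∀ (Y : Lp ℝ ⊤ P) (Yn : ℕ → Lp ℝ ⊤ P), Antitone Yn →
    (∀ᵐ ω ∂P, Tendsto (fun n => Yn n ω) atTop (𝓝 (Y ω))) →
    Tendsto (fun n => ρ (Yn n)) atTop (𝓝 (ρ Y))

/-- The acceptance set of `ρ`. -/
def acceptanceSet {Ω : Type*} [MeasurableSpace Ω] {P : Measure Ω} (ρ : Lp ℝ ⊤ P → ℝ) :
    Set (Lp ℝ ⊤ P) := {Y | ρ Y ≤ 0}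

/-! ### Nash allocation rules -/

/-- `D(X)`: the capital vectors `m` such that `(X, m)` lies in the domain of `Λ` almost surely. -/
def feasibleCapital {Ω : Type*} [MeasurableSpace Ω] {P : Measure Ω} {N : ℕ}
    (Λ : (Fin N → ℝ) × (Fin N → ℝ) → WithBot ℝ) (X : Lp (Fin N → ℝ) ⊤ P) : Set (Fin N → ℝ) :=
  {m | ∀ᵐ ω ∂P, (X ω, m) ∈ effDom Λ}

/-- `L^∞_Λ(ℝ^N)`: the shocks `X` with `D(X) ≠ ∅`. -/
def shockDomain {Ω : Type*} [MeasurableSpace Ω] (P : Measure Ω) {N : ℕ}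
    (Λ : (Fin N → ℝ) × (Fin N → ℝ) → WithBot ℝ) : Set (Lp (Fin N → ℝ) ⊤ P) :=
  {X | (feasibleCapital Λ X).Nonempty}

/-- The random variable `f (X, m)` is (almost surely equal to) an element of `𝒜 ⊆ L^∞(ℝ)`. -/
def IsAccepted {Ω : Type*} [MeasurableSpace Ω] {P : Measure Ω} {N : ℕ} (𝒜 : Set (Lp ℝ ⊤ P))
    (f : (Fin N → ℝ) × (Fin N → ℝ) → WithBot ℝ) (X : Lp (Fin N → ℝ) ⊤ P) (m : Fin N → ℝ) : Prop :=
  ∃ Y ∈ 𝒜, ∀ᵐ ω ∂P, f (X ω, m) = ((Y ω : ℝ) : WithBot ℝ)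

/-- `r` is an `(𝒜, (Λ_i))`-Nash allocation rule: for every `X ∈ L^∞_Λ(ℝ^N)` and every `i`,
`r_i(X) = inf {t | (t, r_{-i}(X)) ∈ D(X) and Λ_i(X, (t, r_{-i}(X))) ∈ 𝒜}`. As `r_i(X)` is real, this
says that the set is nonempty and bounded below with infimum `r_i(X)`, which is what `IsGLB` in `ℝ`
means. -/
def IsNashRule {Ω : Type*} [MeasurableSpace Ω] {P : Measure Ω} {N : ℕ} (𝒜 : Set (Lp ℝ ⊤ P))
    (Λ : (Fin N → ℝ) × (Fin N → ℝ) → WithBot ℝ)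
    (Λi : Fin N → (Fin N → ℝ) × (Fin N → ℝ) → WithBot ℝ)
    (r : shockDomain P Λ → (Fin N → ℝ)) : Prop :=
  ∀ (X : shockDomain P Λ) (i : Fin N),
    IsGLB {t : ℝ | Function.update (r X) i t ∈ feasibleCapital Λ X.1 ∧
      IsAccepted 𝒜 (Λi i) X.1 (Function.update (r X) i t)} (r X i)

end SystemicRisk

open SystemicRisk

/-!
Fix a shock `X`. For the sensitive functions the `i`-th requirement is the sign condition
`0 ≤ h_i(m)` on the surplus `h_i(m) = -ρ(Λ_i(X + m))`, where `m` ranges over the set `D` of feasible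
capital vectors. Since `ρ` is monotone, convex and `1`-Lipschitz for the `L^∞` norm, and `X` is
bounded, `h_i` is real-valued, concave and continuous on `D` (`concaveOn_surplus`,
`continuousOn_surplus`), and `D` is a product of closed upper sets of `ℝ`
(`feasibleCapital_isProduct`).

Existence. The feasibility conditions bound every sensible capital choice: `h_i > 0` when `m_i` is
large and `h_i < 0` when `m_i` is small, uniformly in the other coordinates (`surplus_pos`,
`surplus_neg`, by compactness of the range of `X + m`). On a suitable box in `D`, the fixed points of
the projection of `m - h(m)` to the box are the points with `h_i(m) ≥ 0` and equality unless `m_i` is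
at its lower bound (`exists_complementary_point`). In the case of equality, concavity of `h_i` along
the `i`-th coordinate line and positivity further up give `h_i < 0` below `m_i`, so that `m_i` is the
least acceptable choice of `i` (`exists_nash_capital`). Using complementarity in place of the best
response map avoids any discussion of the continuity of best responses.

The fixed point comes from Brouwer's theorem (`exists_fixedPoint_of_bounded`), proved through the
absence of `C¹` retractions of the ball onto the sphere: if `G` vanishes on the sphere,
`∫ det (1 + t DG)` over the ball is polynomial in `t`, and by change of variables it equals the volume
of the ball for small `t`, hence also for `t = 1` (`integral_ball_det_eq_measure`); for a retraction
`id + G` the determinant at `t = 1` vanishes identically.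

Uniqueness. Self-preference lets a shortfall `δ_j` of the others be compensated by `L ∑ δ_j` of
one's own capital (`le_add_single_of_selfPreferential`), so best responses are `L`-Lipschitz for the
`ℓ¹` norm of the others' capital, and the best response map contracts the sup norm by `L (N - 1) < 1`
(`nash_capital_unique`).
-/

namespace SystemicRisk

/-! ### Brouwer's fixed point theorem -/

section Brouwer

variable {E : Type*} [NormedAddCommGroup E] [InnerProductSpace ℝ E]

/-- A Lipschitz map on a closed ball that vanishes on the bounding sphere stays Lipschitz, with the
same constant, when extended by zero: a segment that leaves the ball meets the sphere. -/
theorem lipschitzWith_indicator_closedBall {K : NNReal} {R : ℝ} {G : E → E}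
    (hG : LipschitzOnWith K G (Metric.closedBall 0 R)) (h0 : ∀ x, ‖x‖ = R → G x = 0) :
    LipschitzWith K ((Metric.closedBall (0 : E) R).indicator G) := by
  have key : ∀ x y : E, x ∈ Metric.closedBall (0 : E) R → y ∉ Metric.closedBall (0 : E) R →
      dist (G x) 0 ≤ K * dist x y := by
    intro x y hx hy
    have hc : ContinuousOn (fun t : ℝ => ‖AffineMap.lineMap x y t‖) (Icc 0 1) :=
      (AffineMap.lineMap_continuous.norm).continuousOn
    obtain ⟨t, ht, htR⟩ := intermediate_value_Icc (zero_le_one' ℝ) hc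
      (show R ∈ Icc _ _ by
        simp only [mem_closedBall_zero_iff, not_le] at hx hy
        simpa using ⟨hx, hy.le⟩)
    simp only at htR
    have hz : AffineMap.lineMap x y t ∈ Metric.closedBall (0 : E) R := by
      simp [htR]
    calc dist (G x) 0 = dist (G x) (G (AffineMap.lineMap x y t)) := by rw [h0 _ htR]
      _ ≤ K * dist x (AffineMap.lineMap x y t) := hG.dist_le_mul _ hx _ hz
      _ ≤ K * dist x y := by
        gcongr
        rw [dist_left_lineMap, Real.norm_of_nonneg ht.1]
        exact mul_le_of_le_one_left dist_nonneg ht.2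
  refine LipschitzWith.of_dist_le_mul fun x y => ?_
  by_cases hx : x ∈ Metric.closedBall (0 : E) R <;> by_cases hy : y ∈ Metric.closedBall (0 : E) R
  · simpa [indicator_of_mem hx, indicator_of_mem hy] using hG.dist_le_mul _ hx _ hy
  · rw [indicator_of_mem hx, indicator_of_notMem hy]
    exact key x y hx hy
  · rw [indicator_of_notMem hx, indicator_of_mem hy, dist_comm, dist_comm x]
    exact key y x hy hx
  · rw [indicator_of_notMem hx, indicator_of_notMem hy, dist_self]
    positivity

variable [FiniteDimensional ℝ E]

/-- `t ↦ det (1 + t A)` is a polynomial of degree at most `dim E`, so its value at `t = 1` is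
given by Lagrange interpolation at any `dim E + 1` nodes, with weights that do not depend on `A`. -/
theorem det_one_add_eq_sum_lagrange (s : Finset ℝ) (hs : Module.finrank ℝ E < s.card)
    (A : E →L[ℝ] E) :
    (1 + A).det = ∑ t ∈ s, (Lagrange.basis s id t).eval 1 * (1 + t • A).det := by
  let b := Module.finBasis ℝ E
  let M := LinearMap.toMatrix b b (A : E →ₗ[ℝ] E)
  let q : Polynomial ℝ :=
    ((Polynomial.X : Polynomial ℝ) • M.map Polynomial.C + (1 : Matrix _ _ ℝ).map Polynomial.C).det
  have hq : ∀ t : ℝ, q.eval t = (1 + t • A).det := by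
    intro t
    have h1 : q.eval t = (t • M + 1).det := by
      rw [← Polynomial.coe_evalRingHom, RingHom.map_det]
      congr 1
      ext i j
      simp [RingHom.mapMatrix_apply, Matrix.one_apply]
      split_ifs <;> simp [mul_comm]
    rw [h1, ContinuousLinearMap.det, ← LinearMap.det_toMatrix b]
    congr 1
    simp [M, add_comm, LinearMap.toMatrix_one]
  have hdeg : q.degree < s.card := by
    refine lt_of_le_of_lt Polynomial.degree_le_natDegree ?_
    refine lt_of_le_of_lt (Nat.cast_le.2 (Polynomial.natDegree_det_X_add_C_le _ _)) ?_
    simpa using hs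
  have h := congrArg (Polynomial.eval 1)
    (Lagrange.eq_interpolate (s := s) (v := id) (f := q) (injOn_id _) hdeg)
  rw [hq, one_smul, Lagrange.interpolate_apply, Polynomial.eval_finsetSum] at h
  rw [h]
  refine Finset.sum_congr rfl fun t _ => ?_
  rw [Polynomial.eval_mul, Polynomial.eval_C, hq, mul_comm]
  rfl

/-- A small perturbation of the identity, supported in a ball, permutes the ball. -/
theorem injOn_image_ball_of_small {K : NNReal} {R t : ℝ} {G : E → E}
    (hG : LipschitzOnWith K G (Metric.closedBall 0 R)) (h0 : ∀ x, ‖x‖ = R → G x = 0)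
    (ht : 0 ≤ t) (htK : t * K < 1) :
    InjOn (fun x => x + t • G x) (Metric.ball 0 R) ∧
      (fun x => x + t • G x) '' Metric.ball 0 R = Metric.ball 0 R := by
  set H := (Metric.closedBall (0 : E) R).indicator G with hH
  have hL := lipschitzWith_indicator_closedBall hG h0
  set F : E → E := fun x => x + t • H x with hF
  have happ : ApproximatesLinearOn F ((ContinuousLinearEquiv.refl ℝ E : E ≃L[ℝ] E) : E →L[ℝ] E)
      univ (t.toNNReal * K) := by
    intro x _ y _
    have : F x - F y - ((ContinuousLinearEquiv.refl ℝ E : E ≃L[ℝ] E) : E →L[ℝ] E) (x - y)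
        = t • (H x - H y) := by
      simp [hF, smul_sub]; abel
    rw [this, norm_smul, Real.norm_of_nonneg ht, NNReal.coe_mul, Real.coe_toNNReal _ ht, mul_assoc]
    gcongr
    simpa [dist_eq_norm] using hL.dist_le_mul x y
  have hsmall : Subsingleton E ∨ t.toNNReal * K <
      ‖((ContinuousLinearEquiv.refl ℝ E).symm : E →L[ℝ] E)‖₊⁻¹ := by
    rcases subsingleton_or_nontrivial E with h | h
    · exact Or.inl h
    · right
      have : ‖((ContinuousLinearEquiv.refl ℝ E).symm : E →L[ℝ] E)‖₊ = 1 := by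
        ext; exact ContinuousLinearMap.norm_id
      rw [this, inv_one, ← NNReal.coe_lt_coe, NNReal.coe_mul, Real.coe_toNNReal _ ht]
      simpa using htK
  have hinj : Function.Injective F := by
    have := happ.injOn hsmall
    rwa [injOn_univ] at this
  have hsurj : Function.Surjective F := happ.surjective hsmall
  have hout : ∀ x, x ∉ Metric.ball (0 : E) R → F x = x := by
    intro x hx
    have : H x = 0 := by
      by_cases h : x ∈ Metric.closedBall (0 : E) R
      · rw [hH, indicator_of_mem h]
        simp only [mem_ball_zero_iff, mem_closedBall_zero_iff, not_lt] at h hx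
        exact h0 x (le_antisymm h hx)
      · rw [hH, indicator_of_notMem h]
    simp [hF, this]
  have heq : EqOn F (fun x => x + t • G x) (Metric.ball 0 R) := by
    intro x hx
    simp [hF, hH, indicator_of_mem (Metric.ball_subset_closedBall hx)]
  refine ⟨(hinj.injOn).congr heq, ?_⟩
  rw [← heq.image_eq]
  apply Subset.antisymm
  · rintro _ ⟨x, hx, rfl⟩
    by_contra h
    have := hinj (hout _ h)
    rw [this] at h
    exact h hx
  · intro y hy
    obtain ⟨x, rfl⟩ := hsurj y
    refine ⟨x, ?_, rfl⟩
    by_contra h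
    rw [hout x h] at hy
    exact h hy

variable [MeasurableSpace E] [BorelSpace E]

/-- For small `t ≥ 0` the map `x ↦ x + t G x` permutes the ball, so `∫ det (1 + t DG)` is the volume of
the ball by change of variables. As this integral is polynomial in `t`, the same holds at `t = 1`,
where `x + G x` need not be injective. -/
theorem integral_ball_det_eq_measure {R : ℝ} {G : E → E}
    (hG : ∀ x ∈ Metric.closedBall (0 : E) R, ContDiffAt ℝ 1 G x) (h0 : ∀ x, ‖x‖ = R → G x = 0) :
    ∫ x in Metric.ball (0 : E) R, (1 + fderiv ℝ G x).det =
      (volume : Measure E).real (Metric.ball 0 R) := by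
  have hcpt : IsCompact (Metric.closedBall (0 : E) R) := isCompact_closedBall _ _
  have hcont : ContinuousOn (fderiv ℝ G) (Metric.closedBall (0 : E) R) := fun x hx =>
    ((hG x hx).fderiv_right (m := 0) (by norm_num)).continuousAt.continuousWithinAt
  obtain ⟨C, hC⟩ := hcpt.exists_bound_of_continuousOn hcont
  have hK : ∀ x ∈ Metric.closedBall (0 : E) R, ‖fderiv ℝ G x‖₊ ≤ C.toNNReal := fun x hx => by
    rw [← NNReal.coe_le_coe]
    exact (hC x hx).trans (Real.le_coe_toNNReal C)
  have hLip : LipschitzOnWith C.toNNReal G (Metric.closedBall (0 : E) R) :=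
    (convex_closedBall _ _).lipschitzOnWith_of_nnnorm_fderiv_le
      (fun x hx => (hG x hx).differentiableAt (by norm_num)) hK
  have hdetc : Continuous fun B : E →L[ℝ] E => (1 + B).det :=
    ContinuousLinearMap.continuous_det.comp (continuous_const.add continuous_id)
  obtain ⟨η, hη, hpos⟩ : ∃ η > 0, ∀ B : E →L[ℝ] E, ‖B‖ < η → 0 < (1 + B).det := by
    have h1 : ∀ᶠ B : E →L[ℝ] E in 𝓝 0, 0 < (1 + B).det := by
      refine hdetc.continuousAt.eventually (lt_mem_nhds ?_)
      simp [ContinuousLinearMap.det]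
    obtain ⟨η, hη, h⟩ := Metric.eventually_nhds_iff.1 h1
    exact ⟨η, hη, fun B hB => h (by simpa using hB)⟩
  set c : ℝ := (C.toNNReal : ℝ) with hc
  have hc0 : 0 ≤ c := NNReal.coe_nonneg _
  have hsmall : ∀ t : ℝ, 0 ≤ t → t * c < 1 → t * c < η →
      ∫ x in Metric.ball (0 : E) R, (1 + t • fderiv ℝ G x).det =
        (volume : Measure E).real (Metric.ball 0 R) := by
    intro t ht ht1 htη
    obtain ⟨hinj, him⟩ := injOn_image_ball_of_small hLip h0 ht ht1
    have hd : ∀ x ∈ Metric.ball (0 : E) R,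
        HasFDerivWithinAt (fun x => x + t • G x) (1 + t • fderiv ℝ G x) (Metric.ball 0 R) x := by
      intro x hx
      have := ((hG x (Metric.ball_subset_closedBall hx)).differentiableAt (by norm_num)).hasFDerivAt
      exact ((hasFDerivAt_id x).add (this.const_smul t)).hasFDerivWithinAt
    have := integral_image_eq_integral_abs_det_fderiv_smul (volume : Measure E)
      measurableSet_ball hd hinj (fun _ => (1 : ℝ))
    rw [him] at this
    simp only [smul_eq_mul, mul_one, setIntegral_const] at this
    rw [this]
    refine setIntegral_congr_fun measurableSet_ball fun x hx => ?_
    refine (abs_of_pos (hpos _ ?_)).symm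
    rw [norm_smul, Real.norm_of_nonneg ht]
    refine lt_of_le_of_lt ?_ htη
    gcongr
    exact hK x (Metric.ball_subset_closedBall hx)
  obtain ⟨δ, hδ, hδ1, hδη⟩ : ∃ δ > 0, δ * c < 1 ∧ δ * c < η := by
    have h1 : Tendsto (fun δ : ℝ => δ * c) (𝓝[>] 0) (𝓝 0) := by
      have : Tendsto (fun δ : ℝ => δ * c) (𝓝 0) (𝓝 (0 * c)) := tendsto_id.mul_const c
      rw [zero_mul] at this
      exact this.mono_left nhdsWithin_le_nhds
    have h2 := (h1.eventually (gt_mem_nhds one_pos)).and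
      ((h1.eventually (gt_mem_nhds hη)).and self_mem_nhdsWithin)
    obtain ⟨δ, a, b, d⟩ := h2.exists
    exact ⟨δ, d, a, b⟩
  obtain ⟨s, hsub, hcard⟩ := (Ioc_infinite hδ).exists_subset_card_eq (Module.finrank ℝ E + 1)
  have hnode : ∀ t ∈ s, ∫ x in Metric.ball (0 : E) R, (1 + t • fderiv ℝ G x).det =
        (volume : Measure E).real (Metric.ball 0 R) := by
    intro t ht
    obtain ⟨h1, h2⟩ := hsub ht
    have : t * c ≤ δ * c := by gcongr
    exact hsmall t h1.le (by linarith) (by linarith)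
  have hint : ∀ t : ℝ, IntegrableOn (fun x => (1 + t • fderiv ℝ G x).det)
      (Metric.ball (0 : E) R) := by
    intro t
    have h1 : ContinuousOn (fun x => (1 + t • fderiv ℝ G x).det) (Metric.closedBall (0 : E) R) :=
      hdetc.comp_continuousOn (hcont.const_smul t)
    exact (h1.integrableOn_compact hcpt).mono_set Metric.ball_subset_closedBall
  have hs1 : ∑ t ∈ s, (Lagrange.basis s id t).eval 1 = (1 : ℝ) := by
    rw [← Polynomial.eval_finsetSum, Lagrange.sum_basis (injOn_id _)
      (Finset.card_pos.1 (by omega)), Polynomial.eval_one]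
  calc ∫ x in Metric.ball (0 : E) R, (1 + fderiv ℝ G x).det
      = ∫ x in Metric.ball (0 : E) R,
          ∑ t ∈ s, (Lagrange.basis s id t).eval 1 * (1 + t • fderiv ℝ G x).det := by
        refine integral_congr_ae (Eventually.of_forall fun x => ?_)
        exact det_one_add_eq_sum_lagrange s (by omega) _
    _ = ∑ t ∈ s, (Lagrange.basis s id t).eval 1 * (volume : Measure E).real (Metric.ball 0 R) := by
        rw [integral_finsetSum _ fun t _ => (hint t).const_mul _]
        refine Finset.sum_congr rfl fun t ht => ?_
        rw [integral_const_mul, hnode t ht]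
    _ = _ := by rw [← Finset.sum_mul, hs1, one_mul]

/-- There is no `C¹` retraction of a ball onto its bounding sphere: its derivative would be singular
everywhere, against `integral_ball_det_eq_measure`. -/
theorem no_contDiff_retraction_sphere {R : ℝ} (hR : 0 < R) {r : E → E}
    (hr : ∀ x ∈ Metric.closedBall (0 : E) R, ContDiffAt ℝ 1 r x)
    (hid : ∀ x, ‖x‖ = R → r x = x)
    (hsph : ∀ x ∈ Metric.closedBall (0 : E) R, ‖r x‖ = R) : False := by
  have h := integral_ball_det_eq_measure (G := fun x => r x - x) (R := R)
    (fun x hx => (hr x hx).sub contDiffAt_id) (fun x hx => by simp [hid x hx])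
  have hz : ∫ x in Metric.ball (0 : E) R, (1 + fderiv ℝ (fun x => r x - x) x).det = 0 := by
    rw [← integral_zero E ℝ (μ := volume.restrict (Metric.ball (0 : E) R))]
    refine setIntegral_congr_fun measurableSet_ball fun x hx => ?_
    have hxc := Metric.ball_subset_closedBall hx
    have hd := ((hr x hxc).differentiableAt (by norm_num)).hasFDerivAt
    have h1 : (1 + fderiv ℝ (fun x => r x - x) x) = fderiv ℝ r x := by
      have h2 : HasFDerivAt (fun x => r x - x) _ x := hd.sub (hasFDerivAt_id x)
      rw [h2.fderiv]
      ext v; simp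
    simp only [h1]
    by_contra hdet
    have hperp : ∀ v, inner ℝ (r x) (fderiv ℝ r x v) = 0 := by
      have e1 : HasFDerivAt (fun y => ‖r y‖ ^ 2) _ x := hd.norm_sq
      have e2 : HasFDerivAt (fun y => ‖r y‖ ^ 2) (0 : E →L[ℝ] ℝ) x := by
        refine (hasFDerivAt_const (R ^ 2) x).congr_of_eventuallyEq ?_
        filter_upwards [Metric.isOpen_ball.mem_nhds hx] with y hy
        rw [hsph y (Metric.ball_subset_closedBall hy)]
      intro v
      have := congrArg (fun A : E →L[ℝ] ℝ => A v) (e1.unique e2)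
      simpa using this
    have hsur : Function.Surjective (fderiv ℝ r x) := by
      have hu : IsUnit (LinearMap.det (fderiv ℝ r x : E →ₗ[ℝ] E)) := isUnit_iff_ne_zero.2 hdet
      exact ((Module.End.isUnit_iff _).1 ((LinearMap.isUnit_iff_isUnit_det _).2 hu)).2
    obtain ⟨v, hv⟩ := hsur (r x)
    have := hperp v
    rw [hv, real_inner_self_eq_norm_sq, hsph x hxc] at this
    exact (pow_pos hR 2).ne' this
  rw [hz] at h
  have : 0 < (volume : Measure E).real (Metric.ball 0 R) :=
    ENNReal.toReal_pos (Metric.measure_ball_pos _ _ hR).ne' measure_ball_lt_top.ne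
  linarith

/-- **Brouwer's fixed point theorem**, for bounded continuous self-maps of a Euclidean space. -/
theorem exists_fixedPoint_of_bounded {f : E → E} (hf : Continuous f) {M : ℝ}
    (hM : ∀ x, ‖f x‖ ≤ M) : ∃ x, f x = x := by
  by_contra! hne
  -- an approximation closer to `f` than the displacement of `f` has no fixed point either
  obtain ⟨g, hg, hgf, -⟩ := hf.exists_contDiff_approx (n := 1)
    (ε := fun x => min 1 ‖f x - x‖)
    (continuous_const.min (hf.sub continuous_id).norm)
    (fun x => lt_min one_pos (norm_pos_iff.2 (sub_ne_zero.2 (hne x))))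
  have hgne : ∀ x, x - g x ≠ 0 := by
    intro x hx
    have := (hgf x).trans_le (min_le_right _ _)
    rw [← sub_eq_zero.1 hx, dist_comm, dist_eq_norm] at this
    exact lt_irrefl _ this
  have hM0 : 0 ≤ M := (norm_nonneg _).trans (hM 0)
  have hgM : ∀ x, ‖g x‖ < M + 1 := by
    intro x
    have h1 := (hgf x).trans_le (min_le_left _ _)
    have h2 : ‖g x‖ ≤ ‖g x - f x‖ + ‖f x‖ := norm_le_norm_sub_add _ _
    rw [dist_eq_norm] at h1
    linarith [hM x]
  set R := M + 1 with hRdef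
  have hR : 0 < R := by positivity
  -- `x + lam x • v x` is the point where the ray from `g x` through `x` leaves the ball;
  -- `lam x` is the larger root of a quadratic equation with discriminant `4 * d x`
  let v : E → E := fun x => x - g x
  let d : E → ℝ := fun x => inner ℝ x (v x) ^ 2 + ‖v x‖ ^ 2 * (R ^ 2 - ‖x‖ ^ 2)
  let lam : E → ℝ := fun x => (-inner ℝ x (v x) + √(d x)) / ‖v x‖ ^ 2
  have hv : ContDiff ℝ 1 v := contDiff_id.sub hg
  have hd : ContDiff ℝ 1 d :=
    ((contDiff_id.inner ℝ hv).pow 2).add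
      ((hv.norm_sq ℝ).mul (contDiff_const.sub (contDiff_id.norm_sq ℝ)))
  have hvpos : ∀ x, 0 < ‖v x‖ ^ 2 := fun x => pow_pos (norm_pos_iff.2 (hgne x)) 2
  have hin : ∀ x, ‖x‖ = R → 0 < inner ℝ x (v x) := by
    intro x hx
    have h1 : inner ℝ x (g x) ≤ ‖x‖ * ‖g x‖ := real_inner_le_norm _ _
    have h2 : ‖x‖ * ‖g x‖ < R * R := by
      rw [hx]; exact mul_lt_mul_of_pos_left (hgM x) hR
    simp only [v, inner_sub_right, real_inner_self_eq_norm_sq]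
    rw [hx] at *
    nlinarith
  have hdpos : ∀ x ∈ Metric.closedBall (0 : E) R, 0 < d x := by
    intro x hx
    rw [mem_closedBall_zero_iff] at hx
    rcases hx.eq_or_lt with h | h
    · simp only [d, h, sub_self, mul_zero, add_zero]
      exact pow_pos (hin x h) 2
    · have : 0 < R ^ 2 - ‖x‖ ^ 2 := by
        have := norm_nonneg x
        nlinarith
      have := mul_pos (hvpos x) this
      positivity
  refine no_contDiff_retraction_sphere hR (r := fun x => x + lam x • v x) ?_ ?_ ?_
  · intro x hx
    have h1 : ContDiffAt ℝ 1 lam x :=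
      (((contDiff_id.inner ℝ hv).neg.contDiffAt).add
        ((hd.contDiffAt).sqrt (hdpos x hx).ne')).div (hv.norm_sq ℝ).contDiffAt (hvpos x).ne'
    exact contDiffAt_id.add (h1.smul hv.contDiffAt)
  · intro x hx
    have : lam x = 0 := by
      simp only [lam, d, hx, sub_self, mul_zero, add_zero, Real.sqrt_sq (hin x hx).le]
      simp
    simp [this]
  · intro x hx
    have hsq : √(d x) ^ 2 = d x := Real.sq_sqrt (hdpos x hx).le
    have e : ‖x + lam x • v x‖ ^ 2 = R ^ 2 := by
      rw [norm_add_sq_real, inner_smul_right, norm_smul, mul_pow, Real.norm_eq_abs, sq_abs]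
      have hl : lam x * ‖v x‖ ^ 2 = -inner ℝ x (v x) + √(d x) := by
        simp only [lam]; exact div_mul_cancel₀ _ (hvpos x).ne'
      have h3 : ‖v x‖ ^ 2 * (‖x‖ ^ 2 + 2 * (lam x * inner ℝ x (v x)) + lam x ^ 2 * ‖v x‖ ^ 2)
          = ‖v x‖ ^ 2 * R ^ 2 := by
        have h4 : (lam x * ‖v x‖ ^ 2 + inner ℝ x (v x)) ^ 2 = d x := by
          rw [hl, neg_add_eq_sub, sub_add_cancel, hsq]
        simp only [d] at h4
        linear_combination h4
      exact mul_left_cancel₀ (hvpos x).ne' h3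
    exact (sq_eq_sq₀ (norm_nonneg _) hR.le).1 e

end Brouwer

/-! ### A nonlinear complementarity problem on a box -/

section Complementarity

/-- If each `h i` is positive on the upper `i`-th face of a box, some point of the box has all `h i`
nonnegative, with `h i = 0` unless the `i`-th coordinate sits at its lower bound. Such a point is a
fixed point of the projection of `m - h m` to the box. -/
theorem exists_complementary_point {N : ℕ} {l u : Fin N → ℝ} (hlu : l ≤ u)
    {h : Fin N → (Fin N → ℝ) → ℝ} (hc : ∀ i, ContinuousOn (h i) (Icc l u))
    (hu : ∀ m ∈ Icc l u, ∀ i, m i = u i → 0 < h i m) :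
    ∃ m ∈ Icc l u, ∀ i, 0 ≤ h i m ∧ (l i < m i → h i m = 0) := by
  let c : (Fin N → ℝ) → Fin N → ℝ := fun m i => max (l i) (min (u i) (m i))
  have hcIcc : ∀ m, c m ∈ Icc l u := fun m =>
    ⟨fun i => le_max_left _ _, fun i => max_le (hlu i) (min_le_left _ _)⟩
  have hcc : Continuous c := by fun_prop
  let F : EuclideanSpace ℝ (Fin N) → EuclideanSpace ℝ (Fin N) := fun x =>
    WithLp.toLp 2 (c fun i => c x.ofLp i - h i (c x.ofLp))
  have hlp : Continuous (WithLp.toLp 2 : (Fin N → ℝ) → EuclideanSpace ℝ (Fin N)) :=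
    PiLp.continuous_toLp 2 _
  have hofLp : Continuous (WithLp.ofLp : EuclideanSpace ℝ (Fin N) → (Fin N → ℝ)) :=
    PiLp.continuous_ofLp 2 _
  have hF : Continuous F := by
    refine hlp.comp (hcc.comp (continuous_pi fun i => ?_))
    have h1 : Continuous fun x : EuclideanSpace ℝ (Fin N) => c x.ofLp := hcc.comp hofLp
    exact ((continuous_apply i).comp h1).sub
      ((hc i).comp_continuous h1 fun x => hcIcc _)
  obtain ⟨M, hM⟩ := (isCompact_Icc (a := l) (b := u)).exists_bound_of_continuousOn
    hlp.continuousOn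
  obtain ⟨x, hx⟩ := exists_fixedPoint_of_bounded hF (M := M) fun x => hM _ (hcIcc _)
  have hxc : x.ofLp = c fun i => c x.ofLp i - h i (c x.ofLp) := (congrArg WithLp.ofLp hx).symm
  have hmem : x.ofLp ∈ Icc l u := hxc ▸ hcIcc _
  have hfix : c x.ofLp = x.ofLp := by
    ext i
    simp only [c, min_eq_right (hmem.2 i), max_eq_right (hmem.1 i)]
  rw [hfix] at hxc
  refine ⟨x.ofLp, hmem, fun i => ?_⟩
  have hi : x.ofLp i = max (l i) (min (u i) (x.ofLp i - h i x.ofLp)) := congrFun hxc i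
  have hnn : 0 ≤ h i x.ofLp := by
    by_contra! hneg
    have h1 : u i ≤ x.ofLp i := by
      by_contra! hlt
      have h2 : x.ofLp i < min (u i) (x.ofLp i - h i x.ofLp) := lt_min hlt (by linarith)
      have h3 := le_max_right (l i) (min (u i) (x.ofLp i - h i x.ofLp))
      rw [← hi] at h3
      exact absurd h3 (not_le.2 h2)
    linarith [hu _ hmem i (le_antisymm (hmem.2 i) h1)]
  refine ⟨hnn, fun hl => ?_⟩
  rcases le_total (l i) (min (u i) (x.ofLp i - h i x.ofLp)) with h4 | h4
  · rw [max_eq_right h4] at hi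
    have := min_le_right (u i) (x.ofLp i - h i x.ofLp)
    linarith
  · rw [max_eq_left h4] at hi
    linarith

end Complementarity

/-! ### Single-element and sensitive aggregation functions -/

section Aggregation

variable {N : ℕ} {f : (Fin N → ℝ) → WithBot ℝ}

theorem coe_finitePart {α : Type*} {g : α → WithBot ℝ} {a : α} (ha : a ∈ effDom g) :
    ((finitePart g a : ℝ) : WithBot ℝ) = g a := by
  obtain ⟨c, hc⟩ := WithBot.ne_bot_iff_exists.1 ha
  simp [finitePart, ← hc]

theorem finitePart_le_finitePart {α : Type*} {g : α → WithBot ℝ} {a b : α} (ha : a ∈ effDom g)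
    (hb : b ∈ effDom g) (hab : g a ≤ g b) : finitePart g a ≤ finitePart g b := by
  rw [← coe_finitePart ha, ← coe_finitePart hb] at hab
  exact WithBot.coe_le_coe.1 hab

theorem IsSingleAggregation.monotone (hf : IsSingleAggregation f) : Monotone f := fun x y hxy =>
  IsAggregation.monotone hf (show (x, (0 : Fin N → ℝ)) ≤ (y, 0) from ⟨hxy, le_rfl⟩)

theorem IsSingleAggregation.isClosed (hf : IsSingleAggregation f) : IsClosed (effDom f) :=
  (IsAggregation.closed_dom hf).preimage
    (show Continuous fun x : Fin N → ℝ => (x, (0 : Fin N → ℝ)) by fun_prop)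

theorem IsSingleAggregation.continuousOn (hf : IsSingleAggregation f) :
    ContinuousOn (finitePart f) (effDom f) :=
  (IsAggregation.continuous hf).comp
    (show Continuous fun x : Fin N → ℝ => (x, (0 : Fin N → ℝ)) by fun_prop).continuousOn
    (fun _ hx => hx)

theorem IsSingleAggregation.concaveOn (hf : IsSingleAggregation f) :
    ConcaveOn ℝ (effDom f) (finitePart f) :=
  (IsAggregation.concave hf).comp_linearMap (LinearMap.inl ℝ (Fin N → ℝ) (Fin N → ℝ))

theorem IsSingleAggregation.isRectUpper (hf : IsSingleAggregation f) : IsRectUpper (effDom f) :=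
  IsAggregation.rect_shock hf 0

theorem IsSingleAggregation.nonempty (hf : IsSingleAggregation f) : (effDom f).Nonempty :=
  let ⟨p, hp⟩ := IsAggregation.nonempty_dom hf
  ⟨p.1, hp⟩

theorem IsSingleAggregation.mem_effDom_of_le (hf : IsSingleAggregation f) {x y : Fin N → ℝ}
    (hx : x ∈ effDom f) (hxy : x ≤ y) : y ∈ effDom f :=
  ne_bot_of_le_ne_bot hx (hf.monotone hxy)

theorem IsRectUpper.add_right {A : Set (Fin N → ℝ)} (hA : IsRectUpper A) (m : Fin N → ℝ) :
    IsRectUpper {x | x + m ∈ A} := by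
  rcases hA with rfl | ⟨S, hS, rfl⟩
  · exact Or.inl (by simp)
  · refine Or.inr ⟨fun i => {t | t + m i ∈ S i}, fun i => ?_, ?_⟩
    · rcases hS i with h | ⟨a, h⟩
      · exact Or.inl (by simp [h])
      · refine Or.inr ⟨a - m i, ?_⟩
        ext t
        simp [h]
    · ext x
      simp [Set.mem_pi]

theorem IsSingleAggregation.isAggregation_sensitive (hf : IsSingleAggregation f) :
    IsAggregation (sensitive f) where
  monotone := fun p q h => hf.monotone (add_le_add h.1 h.2)
  concave := hf.concaveOn.comp_linearMap
    (LinearMap.fst ℝ (Fin N → ℝ) (Fin N → ℝ) + LinearMap.snd ℝ (Fin N → ℝ) (Fin N → ℝ))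
  nonempty_dom := let ⟨x, hx⟩ := hf.nonempty
    ⟨(x, 0), by simpa [effDom, sensitive] using hx⟩
  closed_dom := hf.isClosed.preimage (continuous_fst.add continuous_snd)
  continuous := hf.continuousOn.comp (continuous_fst.add continuous_snd).continuousOn
    (fun _ hp => hp)
  rect_shock := fun m => hf.isRectUpper.add_right m
  rect_capital := fun x => by
    have := hf.isRectUpper.add_right x
    simp only [add_comm _ x] at this
    exact this

/-- Translating a shock by capital turns unilateral changes of capital into unilateral changes of
the argument of the single-element function. -/
theorem add_update_eq (x m : Fin N → ℝ) (i : Fin N) (t : ℝ) :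
    x + Function.update m i (t - x i) = Function.update (x + m) i t := by
  ext j
  by_cases h : j = i
  · subst h; simp
  · simp [h]

theorem IsSingleDecomposition.isDecomposition_sensitive {Λi : Fin N → (Fin N → ℝ) → WithBot ℝ}
    (hdec : IsSingleDecomposition f Λi)
    (hfeas : ∃ xbar ∈ effDom f, ∀ x ∈ effDom f, ∀ i, 0 < Λi i (Function.update x i (xbar i)))
    (hinfeas : ∃ xlow ∈ effDom f, ∀ x ∈ effDom f, ∀ i, ∀ ε : ℝ, 0 < ε →
      Λi i (Function.update x i (xlow i - ε)) < 0) :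
    IsDecomposition (sensitive f) (fun i => sensitive (Λi i)) where
  aggregation := fun i => (hdec.aggregation i).isAggregation_sensitive
  sum_eq := fun p => hdec.sum_eq _
  dom_eq := fun i => congrArg (fun A => (fun p : (Fin N → ℝ) × (Fin N → ℝ) => p.1 + p.2) ⁻¹' A)
    (hdec.dom_eq i)
  self_feasible := by
    obtain ⟨z, hz, h⟩ := hfeas
    refine fun x _ => ⟨z - x, by simpa [effDom, sensitive] using hz, fun m hm i => ?_⟩
    have := h (x + m) hm i
    rwa [← add_update_eq] at this
  self_infeasible := by
    obtain ⟨z, hz, h⟩ := hinfeas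
    refine fun x _ => ⟨z - x, by simpa [effDom, sensitive] using hz, fun m hm i ε hε => ?_⟩
    have := h (x + m) hm i ε hε
    rwa [← add_update_eq, sub_right_comm] at this

end Aggregation

/-! ### The risk of an aggregated position as a function of capital -/

section Position

variable {Ω : Type*} [MeasurableSpace Ω] {P : Measure Ω} {N : ℕ}
  {f : (Fin N → ℝ) → WithBot ℝ}

theorem ae_norm_le_norm_of_top {F : Type*} [NormedAddCommGroup F] (X : Lp F ⊤ P) :
    ∀ᵐ ω ∂P, ‖X ω‖ ≤ ‖X‖ := by
  have hfin : eLpNorm X ⊤ P ≠ ⊤ := Lp.eLpNorm_ne_top X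
  filter_upwards [ae_le_eLpNormEssSup (f := X) (μ := P)] with ω hω
  rw [Lp.norm_def, ← toReal_enorm]
  rw [eLpNorm_exponent_top] at hfin ⊢
  exact ENNReal.toReal_mono hfin hω

theorem memLp_finitePart (hf : IsSingleAggregation f) (X : Lp (Fin N → ℝ) ⊤ P) {m : Fin N → ℝ}
    (hm : m ∈ feasibleCapital (sensitive f) X) :
    MemLp (fun ω => finitePart f (X ω + m)) ⊤ P := by
  classical
  have hmeas : Measurable (finitePart f) := by
    have h := hf.continuousOn.measurable_piecewise
      (continuousOn_const (c := (0 : ℝ)) (s := (effDom f)ᶜ)) hf.isClosed.measurableSet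
    convert h using 1
    ext x
    by_cases hx : x ∈ effDom f
    · simp [hx]
    · have : f x = ⊥ := not_not.1 hx
      simp [hx, finitePart, this]
  have hK : IsCompact (Metric.closedBall (0 : Fin N → ℝ) (‖X‖ + ‖m‖) ∩ effDom f) :=
    (isCompact_closedBall _ _).inter_right hf.isClosed
  obtain ⟨C, hC⟩ := hK.exists_bound_of_continuousOn
    (hf.continuousOn.mono inter_subset_right)
  refine memLp_top_of_bound ?_ C ?_
  · exact (hmeas.comp_aemeasurable
      ((Lp.aestronglyMeasurable X).aemeasurable.add_const m)).aestronglyMeasurable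
  · filter_upwards [hm, ae_norm_le_norm_of_top X] with ω h1 h2
    refine hC _ ⟨?_, h1⟩
    rw [mem_closedBall_zero_iff]
    exact (norm_add_le _ _).trans (by gcongr)

open Classical in
/-- The element of `L^∞` represented by the finite part of `f (X + m)`. It is the intended random
variable when `m` is feasible, and `0` by convention if that finite part is not essentially bounded. -/
noncomputable def aggregatePosition (f : (Fin N → ℝ) → WithBot ℝ) (X : Lp (Fin N → ℝ) ⊤ P)
    (m : Fin N → ℝ) : Lp ℝ ⊤ P :=
  if h : MemLp (fun ω => finitePart f (X ω + m)) ⊤ P then h.toLp else 0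

/-- The acceptability surplus `-ρ(f(X + m))` of the aggregated position: it is nonnegative exactly
when the capital `m` makes the position acceptable. -/
noncomputable def surplus (ρ : Lp ℝ ⊤ P → ℝ) (f : (Fin N → ℝ) → WithBot ℝ)
    (X : Lp (Fin N → ℝ) ⊤ P) (m : Fin N → ℝ) : ℝ :=
  -ρ (aggregatePosition f X m)

theorem aggregatePosition_ae (hf : IsSingleAggregation f) {X : Lp (Fin N → ℝ) ⊤ P}
    {m : Fin N → ℝ} (hm : m ∈ feasibleCapital (sensitive f) X) :
    aggregatePosition f X m =ᵐ[P] fun ω => finitePart f (X ω + m) := by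
  rw [aggregatePosition, dif_pos (memLp_finitePart hf X hm)]
  exact MemLp.coeFn_toLp _

/-- Acceptability of a feasible capital vector is the sign condition on its surplus. -/
theorem isAccepted_iff_surplus_nonneg {ρ : Lp ℝ ⊤ P → ℝ} (hf : IsSingleAggregation f)
    {X : Lp (Fin N → ℝ) ⊤ P} {m : Fin N → ℝ} (hm : m ∈ feasibleCapital (sensitive f) X) :
    IsAccepted (acceptanceSet ρ) (sensitive f) X m ↔ 0 ≤ surplus ρ f X m := by
  have hpos := aggregatePosition_ae hf hm
  rw [surplus, neg_nonneg]
  constructor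
  · rintro ⟨Y, hY, hYf⟩
    have : Y = aggregatePosition f X m := by
      apply Lp.ext
      filter_upwards [hpos, hYf] with ω h1 h2
      rw [h1, finitePart]
      change f (X ω + m) = _ at h2
      rw [h2]; rfl
    rw [← this]; exact hY
  · intro h
    refine ⟨_, h, ?_⟩
    filter_upwards [hpos, hm] with ω h1 h2
    rw [h1]
    exact (coe_finitePart (g := f) h2).symm

theorem feasibleCapital_congr {f g : (Fin N → ℝ) → WithBot ℝ} (h : effDom f = effDom g)
    (X : Lp (Fin N → ℝ) ⊤ P) :
    feasibleCapital (sensitive f) X = feasibleCapital (sensitive g) X := by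
  have : ∀ m, (∀ᵐ ω ∂P, X ω + m ∈ effDom f) ↔ (∀ᵐ ω ∂P, X ω + m ∈ effDom g) := by simp [h]
  exact Set.ext this

variable [IsProbabilityMeasure P] {ρ : Lp ℝ ⊤ P → ℝ}

/-- One-sided form of the fact that `ρ` is `1`-Lipschitz for the norm of `L^∞`. -/
theorem IsCoherentRiskMeasure.neg_le_neg_add (hρ : IsCoherentRiskMeasure ρ) {Y Z : Lp ℝ ⊤ P}
    {c : ℝ} (h : ∀ᵐ ω ∂P, Y ω ≤ Z ω + c) : -ρ Y ≤ -ρ Z + c := by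
  have h1 : Y ≤ Z + Lp.const ⊤ P c := by
    rw [← Lp.coeFn_le]
    filter_upwards [h, Lp.coeFn_add Z (Lp.const ⊤ P c), Lp.coeFn_const ⊤ P c] with ω h1 h2 h3
    rw [h2, Pi.add_apply, h3]
    exact h1
  have h2 := hρ.monotone _ _ h1
  rw [hρ.translative] at h2
  linarith

theorem surplus_le_add (hρ : IsCoherentRiskMeasure ρ) (hf : IsSingleAggregation f)
    {X : Lp (Fin N → ℝ) ⊤ P} {m m' : Fin N → ℝ} (hm : m ∈ feasibleCapital (sensitive f) X)
    (hm' : m' ∈ feasibleCapital (sensitive f) X) {c : ℝ}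
    (h : ∀ᵐ ω ∂P, finitePart f (X ω + m) ≤ finitePart f (X ω + m') + c) :
    surplus ρ f X m ≤ surplus ρ f X m' + c := by
  refine hρ.neg_le_neg_add ?_
  filter_upwards [h, aggregatePosition_ae hf hm, aggregatePosition_ae hf hm'] with ω h1 h2 h3
  rwa [h2, h3]

theorem le_surplus (hρ : IsCoherentRiskMeasure ρ) (hf : IsSingleAggregation f)
    {X : Lp (Fin N → ℝ) ⊤ P} {m : Fin N → ℝ} (hm : m ∈ feasibleCapital (sensitive f) X) {c : ℝ}
    (h : ∀ᵐ ω ∂P, c ≤ finitePart f (X ω + m)) : c ≤ surplus ρ f X m := by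
  have := hρ.neg_le_neg_add (Y := 0) (Z := aggregatePosition f X m) (c := -c) (by
    filter_upwards [h, aggregatePosition_ae hf hm, Lp.coeFn_zero ℝ ⊤ P] with ω h1 h2 h3
    rw [h2, h3, Pi.zero_apply]
    linarith)
  rw [hρ.normalized] at this
  rw [surplus]
  linarith

theorem surplus_le (hρ : IsCoherentRiskMeasure ρ) (hf : IsSingleAggregation f)
    {X : Lp (Fin N → ℝ) ⊤ P} {m : Fin N → ℝ} (hm : m ∈ feasibleCapital (sensitive f) X) {c : ℝ}
    (h : ∀ᵐ ω ∂P, finitePart f (X ω + m) ≤ c) : surplus ρ f X m ≤ c := by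
  have := hρ.neg_le_neg_add (Z := 0) (Y := aggregatePosition f X m) (c := c) (by
    filter_upwards [h, aggregatePosition_ae hf hm, Lp.coeFn_zero ℝ ⊤ P] with ω h1 h2 h3
    rw [h2, h3, Pi.zero_apply]
    linarith)
  rw [hρ.normalized] at this
  rw [surplus]
  linarith

/-- Strict positivity survives `ρ` because the values of `X + m` stay in a compact set. -/
theorem surplus_pos (hρ : IsCoherentRiskMeasure ρ) (hf : IsSingleAggregation f)
    {X : Lp (Fin N → ℝ) ⊤ P} {m : Fin N → ℝ} (hm : m ∈ feasibleCapital (sensitive f) X)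
    {A : Set (Fin N → ℝ)} (hA : IsClosed A) (hXA : ∀ᵐ ω ∂P, X ω + m ∈ A)
    (h : ∀ z ∈ effDom f, z ∈ A → 0 < f z) : 0 < surplus ρ f X m := by
  have hK : IsCompact (Metric.closedBall (0 : Fin N → ℝ) (‖X‖ + ‖m‖) ∩ effDom f ∩ A) :=
    ((isCompact_closedBall _ _).inter_right hf.isClosed).inter_right hA
  obtain ⟨c, hc, hcK⟩ := hK.exists_forall_le' (a := 0)
    (hf.continuousOn.mono (inter_subset_left.trans inter_subset_right)) (fun z hz => by
      have := h z hz.1.2 hz.2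
      rw [← coe_finitePart hz.1.2] at this
      exact WithBot.coe_pos.1 this)
  refine lt_of_lt_of_le hc (le_surplus hρ hf hm ?_)
  filter_upwards [hXA, hm, ae_norm_le_norm_of_top X] with ω h1 h2 h3
  refine hcK _ ⟨⟨?_, h2⟩, h1⟩
  rw [mem_closedBall_zero_iff]
  exact (norm_add_le _ _).trans (by gcongr)

/-- The counterpart of `surplus_pos` for strict negativity. -/
theorem surplus_neg (hρ : IsCoherentRiskMeasure ρ) (hf : IsSingleAggregation f)
    {X : Lp (Fin N → ℝ) ⊤ P} {m : Fin N → ℝ} (hm : m ∈ feasibleCapital (sensitive f) X)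
    {A : Set (Fin N → ℝ)} (hA : IsClosed A) (hXA : ∀ᵐ ω ∂P, X ω + m ∈ A)
    (h : ∀ z ∈ effDom f, z ∈ A → f z < 0) : surplus ρ f X m < 0 := by
  have hK : IsCompact (Metric.closedBall (0 : Fin N → ℝ) (‖X‖ + ‖m‖) ∩ effDom f ∩ A) :=
    ((isCompact_closedBall _ _).inter_right hf.isClosed).inter_right hA
  obtain ⟨c, hc, hcK⟩ := hK.exists_forall_le' (a := 0)
    (hf.continuousOn.mono (inter_subset_left.trans inter_subset_right)).neg (fun z hz => by
      have := h z hz.1.2 hz.2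
      rw [← coe_finitePart hz.1.2] at this
      exact neg_pos.2 (WithBot.coe_lt_coe.1 this))
  refine lt_of_le_of_lt (surplus_le hρ hf hm (c := -c) ?_) (neg_lt_zero.2 hc)
  filter_upwards [hXA, hm, ae_norm_le_norm_of_top X] with ω h1 h2 h3
  refine le_neg_of_le_neg (hcK _ ⟨⟨?_, h2⟩, h1⟩)
  rw [mem_closedBall_zero_iff]
  exact (norm_add_le _ _).trans (by gcongr)

theorem continuousOn_surplus (hρ : IsCoherentRiskMeasure ρ) (hf : IsSingleAggregation f)
    (X : Lp (Fin N → ℝ) ⊤ P) :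
    ContinuousOn (surplus ρ f X) (feasibleCapital (sensitive f) X) := by
  intro m hm
  rw [ContinuousWithinAt, Metric.tendsto_nhdsWithin_nhds]
  intro ε hε
  have hK : IsCompact (Metric.closedBall (0 : Fin N → ℝ) (‖X‖ + (‖m‖ + 1)) ∩ effDom f) :=
    (isCompact_closedBall _ _).inter_right hf.isClosed
  obtain ⟨δ, hδ, huc⟩ := Metric.uniformContinuousOn_iff_le.1
    (hK.uniformContinuousOn_of_continuous (hf.continuousOn.mono inter_subset_right)) (ε / 2)
    (half_pos hε)
  refine ⟨min δ 1, lt_min hδ one_pos, fun m' hm' hd => ?_⟩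
  have hd1 : dist m' m ≤ δ := hd.le.trans (min_le_left _ _)
  have hn : ‖m'‖ ≤ ‖m‖ + 1 := by
    have h1 := hd.le.trans (min_le_right _ _)
    rw [dist_eq_norm] at h1
    linarith [norm_le_norm_sub_add m' m]
  have hae : ∀ᵐ ω ∂P, |finitePart f (X ω + m') - finitePart f (X ω + m)| ≤ ε / 2 := by
    filter_upwards [hm, hm', ae_norm_le_norm_of_top X] with ω h1 h2 h3
    refine huc _ ⟨?_, h2⟩ _ ⟨?_, h1⟩ (by simpa using hd1)
    · rw [mem_closedBall_zero_iff]
      exact (norm_add_le _ _).trans (by gcongr)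
    · rw [mem_closedBall_zero_iff]
      exact (norm_add_le _ _).trans (by gcongr; linarith)
  have h1 : surplus ρ f X m' ≤ surplus ρ f X m + ε / 2 := surplus_le_add hρ hf hm' hm (by
    filter_upwards [hae] with ω h
    linarith [(abs_le.1 h).2])
  have h2 : surplus ρ f X m ≤ surplus ρ f X m' + ε / 2 := surplus_le_add hρ hf hm hm' (by
    filter_upwards [hae] with ω h
    linarith [(abs_le.1 h).1])
  rw [Real.dist_eq, abs_lt]
  constructor <;> linarith

theorem concaveOn_surplus (hρ : IsCoherentRiskMeasure ρ) (hf : IsSingleAggregation f)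
    (X : Lp (Fin N → ℝ) ⊤ P) :
    ConcaveOn ℝ (feasibleCapital (sensitive f) X) (surplus ρ f X) := by
  have hcomb : ∀ (x m m' : Fin N → ℝ) (a b : ℝ), a + b = 1 →
      x + (a • m + b • m') = a • (x + m) + b • (x + m') := by
    intro x m m' a b hab
    obtain rfl : b = 1 - a := by linarith
    module
  have hconv : Convex ℝ (feasibleCapital (sensitive f) X) := by
    intro m hm m' hm' a b ha hb hab
    change ∀ᵐ ω ∂P, X ω + (a • m + b • m') ∈ effDom f
    filter_upwards [hm, hm'] with ω h1 h2
    have := hf.concaveOn.1 h1 h2 ha hb hab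
    rwa [← hcomb _ _ _ _ _ hab] at this
  refine ⟨hconv, fun m hm m' hm' a b ha hb hab => ?_⟩
  have hle : a • aggregatePosition f X m + b • aggregatePosition f X m' ≤
      aggregatePosition f X (a • m + b • m') := by
    rw [← Lp.coeFn_le]
    filter_upwards [hm, hm', aggregatePosition_ae hf hm, aggregatePosition_ae hf hm',
      aggregatePosition_ae hf (hconv hm hm' ha hb hab),
      Lp.coeFn_add (a • aggregatePosition f X m) (b • aggregatePosition f X m'),
      Lp.coeFn_smul a (aggregatePosition f X m), Lp.coeFn_smul b (aggregatePosition f X m')]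
      with ω h1 h2 e1 e2 e3 e4 e5 e6
    rw [e3, e4, Pi.add_apply, e5, e6, Pi.smul_apply, Pi.smul_apply, e1, e2,
      hcomb _ _ _ _ _ hab]
    exact hf.concaveOn.2 h1 h2 ha hb hab
  obtain rfl : b = 1 - a := by linarith
  have h1 := hρ.monotone _ _ hle
  have h2 := hρ.convex (aggregatePosition f X m) (aggregatePosition f X m') a ha (by linarith)
  simp only [surplus, smul_eq_mul]
  linarith

end Position

/-! ### Existence and uniqueness of Nash allocations -/

section Nash

variable {Ω : Type*} [MeasurableSpace Ω] {P : Measure Ω} {N : ℕ}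
  {Λ : (Fin N → ℝ) → WithBot ℝ} {Λi : Fin N → (Fin N → ℝ) → WithBot ℝ}

/-- Feasibility of a capital vector is a condition on each coordinate separately, closed and stable
under adding capital. -/
theorem feasibleCapital_isProduct (hΛ : IsSingleAggregation Λ) (X : Lp (Fin N → ℝ) ⊤ P) :
    ∃ T : Fin N → Set ℝ, (∀ i, IsClosed (T i) ∧ IsUpperSet (T i)) ∧
      feasibleCapital (sensitive Λ) X = Set.pi univ T := by
  rcases hΛ.isRectUpper with h | ⟨S, hS, h⟩
  · exact absurd h hΛ.nonempty.ne_empty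
  have hSc : ∀ i, IsClosed (S i) ∧ IsUpperSet (S i) := by
    intro i
    rcases hS i with h | ⟨a, h⟩
    · exact h ▸ ⟨isClosed_univ, isUpperSet_univ⟩
    · exact h ▸ ⟨isClosed_Ici, isUpperSet_Ici a⟩
  refine ⟨fun i => {t | ∀ᵐ ω ∂P, X ω i + t ∈ S i}, fun i => ⟨?_, ?_⟩, ?_⟩
  · refine IsSeqClosed.isClosed fun t s ht hts => ?_
    have hall : ∀ᵐ ω ∂P, ∀ n, X ω i + t n ∈ S i := ae_all_iff.2 ht
    filter_upwards [hall] with ω hω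
    exact (hSc i).1.mem_of_tendsto (hts.const_add (X ω i)) (Eventually.of_forall hω)
  · intro s t hst hs
    change ∀ᵐ ω ∂P, X ω i + t ∈ S i
    filter_upwards [hs] with ω hω
    exact (hSc i).2 (add_le_add_right hst _) hω
  · ext m
    change (∀ᵐ ω ∂P, X ω + m ∈ effDom Λ) ↔ _
    simp only [h, Set.mem_pi, mem_univ, true_implies, Pi.add_apply, mem_ofPred_eq]
    exact ae_all_iff

theorem add_norm_mem_feasibleCapital (hΛ : IsSingleAggregation Λ) (X : Lp (Fin N → ℝ) ⊤ P)
    {x m : Fin N → ℝ} (hx : x ∈ effDom Λ) (hm : ∀ i, x i + ‖X‖ ≤ m i) :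
    m ∈ feasibleCapital (sensitive Λ) X := by
  change ∀ᵐ ω ∂P, X ω + m ∈ effDom Λ
  filter_upwards [ae_norm_le_norm_of_top X] with ω hω
  refine hΛ.mem_effDom_of_le hx fun i => ?_
  have h1 := (neg_le_abs (X ω i)).trans ((norm_le_pi_norm (X ω) i).trans hω)
  have := hm i
  simp only [Pi.add_apply]
  linarith

theorem shockDomain_sensitive_eq_univ (hΛ : IsSingleAggregation Λ) :
    shockDomain P (sensitive Λ) = Set.univ := by
  obtain ⟨x, hx⟩ := hΛ.nonempty
  exact eq_univ_of_forall fun X =>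
    ⟨fun i => x i + ‖X‖, add_norm_mem_feasibleCapital hΛ X hx fun _ => le_rfl⟩

variable [IsProbabilityMeasure P] {ρ : Lp ℝ ⊤ P → ℝ}

/-- A solution of the complementarity problem for the surpluses is a Nash allocation: where the `i`-th
surplus vanishes, concavity along the `i`-th coordinate line, together with positivity further up,
makes it negative further down; where it does not vanish, less capital is infeasible. -/
theorem exists_nash_capital (hρ : IsCoherentRiskMeasure ρ) (hΛ : IsSingleAggregation Λ)
    (hdec : IsSingleDecomposition Λ Λi)
    (hfeas : ∃ xbar ∈ effDom Λ, ∀ x ∈ effDom Λ, ∀ i, 0 < Λi i (Function.update x i (xbar i)))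
    (hinfeas : ∃ xlow ∈ effDom Λ, ∀ x ∈ effDom Λ, ∀ i, ∀ ε : ℝ, 0 < ε →
      Λi i (Function.update x i (xlow i - ε)) < 0) (X : Lp (Fin N → ℝ) ⊤ P) :
    ∃ r : Fin N → ℝ, ∀ i, IsGLB {t : ℝ |
      Function.update r i t ∈ feasibleCapital (sensitive Λ) X ∧
      IsAccepted (acceptanceSet ρ) (sensitive (Λi i)) X (Function.update r i t)} (r i) := by
  obtain ⟨xbar, hxbar, hfeas⟩ := hfeas
  obtain ⟨xlow, hxlow, hinfeas⟩ := hinfeas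
  obtain ⟨T, hT, hD⟩ := feasibleCapital_isProduct hΛ X
  set D := feasibleCapital (sensitive Λ) X with hDdef
  have hagg := hdec.aggregation
  have hDi : ∀ i, feasibleCapital (sensitive (Λi i)) X = D := fun i =>
    feasibleCapital_congr (hdec.dom_eq i) X
  let u : Fin N → ℝ := fun i => max (xbar i + ‖X‖) (xlow i - ‖X‖)
  have huD : u ∈ D := add_norm_mem_feasibleCapital hΛ X hxbar fun i => le_max_left _ _
  have huT : ∀ i, u i ∈ T i := fun i => by
    rw [hD] at huD; exact huD i trivial
  -- the lower bound is low enough to make the surplus negative, or else the domain ends there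
  have hl : ∀ i, ∃ l ∈ T i, l ≤ u i ∧ (l = xlow i - ‖X‖ - 1 ∨ IsLeast (T i) l) := by
    intro i
    by_cases h : xlow i - ‖X‖ - 1 ∈ T i
    · exact ⟨_, h, by have := le_max_right (xbar i + ‖X‖) (xlow i - ‖X‖); linarith, Or.inl rfl⟩
    · have hbdd : BddBelow (T i) := ⟨xlow i - ‖X‖ - 1, fun t ht => by
        by_contra! hlt
        exact h ((hT i).2 hlt.le ht)⟩
      have hleast : IsLeast (T i) (sInf (T i)) :=
        ⟨(hT i).1.csInf_mem ⟨_, huT i⟩ hbdd, fun t ht => csInf_le hbdd ht⟩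
      exact ⟨_, hleast.1, hleast.2 (huT i), Or.inr hleast⟩
  choose l hlT hlu hl using hl
  have hIcc : Icc l u ⊆ D := fun m hm => by
    rw [hD]; exact fun i _ => (hT i).2 (hm.1 i) (hlT i)
  have hupos : ∀ m ∈ Icc l u, ∀ i, m i = u i → 0 < surplus ρ (Λi i) X m := by
    intro m hm i hmi
    refine surplus_pos hρ (hagg i) (hDi i ▸ hIcc hm)
      (isClosed_Ici.preimage (continuous_apply i) : IsClosed {z : Fin N → ℝ | xbar i ≤ z i}) ?_ ?_
    · filter_upwards [ae_norm_le_norm_of_top X] with ω hω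
      have h1 := (neg_le_abs (X ω i)).trans ((norm_le_pi_norm (X ω) i).trans hω)
      have h2 := le_max_left (xbar i + ‖X‖) (xlow i - ‖X‖)
      change xbar i ≤ X ω i + m i
      rw [hmi]
      linarith
    · intro z hz hzi
      refine (hfeas z (hdec.dom_eq i ▸ hz) i).trans_le ((hagg i).monotone ?_)
      exact update_le_self_iff.2 hzi
  have hlneg : ∀ m ∈ D, ∀ i, m i = xlow i - ‖X‖ - 1 → surplus ρ (Λi i) X m < 0 := by
    intro m hm i hmi
    refine surplus_neg hρ (hagg i) (hDi i ▸ hm)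
      (isClosed_Iic.preimage (continuous_apply i) : IsClosed {z : Fin N → ℝ | z i ≤ xlow i - 1})
      ?_ ?_
    · filter_upwards [ae_norm_le_norm_of_top X] with ω hω
      have h1 := (le_abs_self (X ω i)).trans ((norm_le_pi_norm (X ω) i).trans hω)
      change X ω i + m i ≤ xlow i - 1
      rw [hmi]
      linarith
    · intro z hz hzi
      change z i ≤ xlow i - 1 at hzi
      have := hinfeas z (hdec.dom_eq i ▸ hz) i (xlow i - z i) (by linarith)
      rwa [sub_sub_cancel, Function.update_eq_self] at this
  obtain ⟨m, hm, hcomp⟩ := exists_complementary_point (l := l) (u := u) hlu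
    (h := fun i => surplus ρ (Λi i) X)
    (fun i => (continuousOn_surplus hρ (hagg i) X).mono (hDi i ▸ hIcc)) hupos
  have hmD := hIcc hm
  have hacc : ∀ i, ∀ m ∈ D, IsAccepted (acceptanceSet ρ) (sensitive (Λi i)) X m ↔
      0 ≤ surplus ρ (Λi i) X m := fun i m hm =>
    isAccepted_iff_surplus_nonneg (hagg i) (hDi i ▸ hm)
  refine ⟨m, fun i => ⟨fun t ht => ?_, fun b hb => hb ?_⟩⟩
  · obtain ⟨htD, hta⟩ := ht
    rw [hacc i _ htD] at hta
    by_contra! htm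
    have hlm : l i < m i := by
      rcases hl i with h | h
      · refine lt_of_le_of_ne (hm.1 i) fun heq => ?_
        exact absurd (hcomp i).1 (not_le.2 (hlneg m hmD i (heq ▸ h)))
      · refine lt_of_le_of_lt (h.2 ?_) htm
        rw [hD] at htD
        simpa using htD i trivial
    have hz := (hcomp i).2 hlm
    have hmu : m i < u i := lt_of_le_of_ne (hm.2 i) fun heq => (hupos m hm i heq).ne' hz
    have hqI : Function.update m i (u i) ∈ Icc l u := by
      refine ⟨fun j => ?_, fun j => ?_⟩ <;> by_cases hj : j = i
      · subst hj; simpa using hlu j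
      · simpa [hj] using hm.1 j
      · subst hj; simp
      · simpa [hj] using hm.2 j
    have hq := hupos _ hqI i (by simp)
    -- `m` lies strictly between two points of its `i`-th line with nonnegative surplus
    have hden : 0 < u i - t := by linarith
    have hcc := (concaveOn_surplus hρ (hagg i) X).2 (hDi i ▸ htD) (hDi i ▸ hIcc hqI)
      (div_nonneg (by linarith) hden.le : 0 ≤ (u i - m i) / (u i - t))
      (div_nonneg (by linarith) hden.le : 0 ≤ (m i - t) / (u i - t))
      (by field_simp; ring)
    have hcomb : ((u i - m i) / (u i - t)) • Function.update m i t +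
        ((m i - t) / (u i - t)) • Function.update m i (u i) = m := by
      ext j
      by_cases hj : j = i
      · subst hj
        simp only [Pi.add_apply, Pi.smul_apply, Function.update_self, smul_eq_mul]
        field_simp
        ring
      · simp only [Pi.add_apply, Pi.smul_apply, Function.update_of_ne hj, smul_eq_mul]
        field_simp
        ring
    rw [hcomb, hz] at hcc
    have h1 : 0 < (m i - t) / (u i - t) := div_pos (by linarith) hden
    have h2 : 0 ≤ (u i - m i) / (u i - t) := div_nonneg (by linarith) hden.le
    have h3 := mul_pos h1 hq
    have h4 := mul_nonneg h2 hta
    simp only [smul_eq_mul] at hcc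
    linarith
  · rw [mem_ofPred_eq, Function.update_eq_self]
    exact ⟨hmD, (hacc i m hmD).2 (hcomp i).1⟩

/-- Self-preference, applied to one coordinate after another: capital moved from the coordinates in `S`
to coordinate `i` may be discounted by the factor `L`. -/
theorem le_add_single_of_selfPreferential (hΛ : IsSingleAggregation Λ) {L : ℝ} (hL : 0 ≤ L)
    (hpref : ∀ i j, i ≠ j → ∀ x ∈ effDom Λ, ∀ α : ℝ, 0 ≤ α →
      Λi i (x + Pi.single j α) ≤ Λi i (x + Pi.single i (L * α)))
    (i : Fin N) {δ : Fin N → ℝ} (hδ : 0 ≤ δ) (S : Finset (Fin N)) (hS : i ∉ S) :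
    ∀ x ∈ effDom Λ, Λi i (x + ∑ j ∈ S, Pi.single j (δ j)) ≤
      Λi i (x + Pi.single i (L * ∑ j ∈ S, δ j)) := by
  induction S using Finset.induction_on with
  | empty => intro x _; simp
  | insert k S hk ih =>
    intro x hx
    have hki : i ≠ k := fun h => hS (h ▸ Finset.mem_insert_self _ _)
    have hS' : i ∉ S := fun h => hS (Finset.mem_insert_of_mem h)
    have hmem : ∀ (j : Fin N) (c : ℝ), 0 ≤ c → x + Pi.single j c ∈ effDom Λ := fun j c hc =>
      hΛ.mem_effDom_of_le hx (le_add_of_nonneg_right (Pi.single_nonneg.2 hc))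
    have hsum : 0 ≤ L * ∑ j ∈ S, δ j := mul_nonneg hL (Finset.sum_nonneg fun j _ => hδ j)
    rw [Finset.sum_insert hk, Finset.sum_insert hk, ← add_assoc]
    refine (ih hS' _ (hmem k _ (hδ k))).trans ?_
    rw [add_right_comm]
    refine (hpref i k hki _ (hmem i _ hsum) _ (hδ k)).trans_eq ?_
    rw [add_assoc, ← Pi.single_add]
    ring_nf

/-- The best response of `i` is `L`-Lipschitz in the `ℓ¹` norm of the capital of the others. -/
theorem nash_capital_le_add (hρ : IsCoherentRiskMeasure ρ) (hΛ : IsSingleAggregation Λ)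
    (hdec : IsSingleDecomposition Λ Λi) {L : ℝ} (hL : 0 ≤ L)
    (hpref : ∀ i j, i ≠ j → ∀ x ∈ effDom Λ, ∀ α : ℝ, 0 ≤ α →
      Λi i (x + Pi.single j α) ≤ Λi i (x + Pi.single i (L * α)))
    {X : Lp (Fin N → ℝ) ⊤ P} {r r' : Fin N → ℝ} {i : Fin N}
    (hr : IsGLB {t : ℝ | Function.update r i t ∈ feasibleCapital (sensitive Λ) X ∧
      IsAccepted (acceptanceSet ρ) (sensitive (Λi i)) X (Function.update r i t)} (r i))
    (hr' : IsGLB {t : ℝ | Function.update r' i t ∈ feasibleCapital (sensitive Λ) X ∧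
      IsAccepted (acceptanceSet ρ) (sensitive (Λi i)) X (Function.update r' i t)} (r' i)) :
    r i ≤ r' i + L * ∑ j ∈ Finset.univ.erase i, |r j - r' j| := by
  obtain ⟨T, hT, hD⟩ := feasibleCapital_isProduct hΛ X
  have hagg := hdec.aggregation i
  have hDi : feasibleCapital (sensitive (Λi i)) X = feasibleCapital (sensitive Λ) X :=
    feasibleCapital_congr (hdec.dom_eq i) X
  set δ : Fin N → ℝ := fun j => |r j - r' j| with hδdef
  have hδ : 0 ≤ δ := fun j => abs_nonneg _
  set c := L * ∑ j ∈ Finset.univ.erase i, δ j with hc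
  have hc0 : 0 ≤ c := mul_nonneg hL (Finset.sum_nonneg fun j _ => hδ j)
  rw [← sub_le_iff_le_add]
  refine hr'.2 fun t ⟨htD, hta⟩ => ?_
  rw [sub_le_iff_le_add]
  refine hr.1 ?_
  -- feasibility of the capital is a coordinatewise condition
  obtain ⟨t₀, ht₀, -⟩ := hr.nonempty
  have hm₀ : Function.update r i t ∈ feasibleCapital (sensitive Λ) X := by
    rw [hD] at ht₀ htD ⊢
    intro j _
    by_cases hj : j = i
    · subst hj; simpa using htD j trivial
    · simpa [hj] using ht₀ j trivial
  have hupd : Function.update r i (t + c) = Function.update r i t + Pi.single i c := by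
    ext j
    by_cases hj : j = i
    · subst hj; simp
    · simp [hj]
  have hm₁ : Function.update r i (t + c) ∈ feasibleCapital (sensitive Λ) X := by
    change ∀ᵐ ω ∂P, X ω + Function.update r i (t + c) ∈ effDom Λ
    filter_upwards [hm₀] with ω hω
    refine hΛ.mem_effDom_of_le (x := X ω + Function.update r i t) hω ?_
    rw [hupd]
    gcongr
    exact le_add_of_nonneg_right (Pi.single_nonneg.2 hc0)
  have hle : Function.update r' i t ≤
      Function.update r i t + ∑ j ∈ Finset.univ.erase i, Pi.single j (δ j) := by
    intro j
    rw [Pi.add_apply, Finset.sum_apply]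
    by_cases hj : j = i
    · subst hj
      simp only [Function.update_self]
      exact le_add_of_nonneg_right (Finset.sum_nonneg fun k _ =>
        (Pi.single_nonneg.2 (hδ k) : (0 : Fin N → ℝ) ≤ Pi.single k (δ k)) j)
    · have hs : ∑ k ∈ Finset.univ.erase i, (Pi.single k (δ k) : Fin N → ℝ) j = δ j := by
        rw [Finset.sum_eq_single j]
        · simp
        · intro k _ hkj; simp [hkj.symm]
        · intro h; exact absurd (by simp [hj]) h
      rw [hs, Function.update_of_ne hj, Function.update_of_ne hj]
      have := neg_abs_le (r j - r' j)
      simp only [hδdef]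
      linarith
  refine ⟨hm₁, ?_⟩
  rw [isAccepted_iff_surplus_nonneg hagg (hDi ▸ htD)] at hta
  rw [isAccepted_iff_surplus_nonneg hagg (hDi ▸ hm₁)]
  have h := surplus_le_add (c := 0) hρ hagg (hDi ▸ htD) (hDi ▸ hm₁) ?_
  · linarith
  · filter_upwards [htD, hm₀, hm₁] with ω h1 h2 h3
    rw [add_zero]
    change X ω + _ ∈ effDom Λ at h1 h2 h3
    refine finitePart_le_finitePart (hdec.dom_eq i ▸ h1) (hdec.dom_eq i ▸ h3) ?_
    calc Λi i (X ω + Function.update r' i t)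
        ≤ Λi i (X ω + Function.update r i t + ∑ j ∈ Finset.univ.erase i, Pi.single j (δ j)) := by
          rw [add_assoc]
          exact hagg.monotone (add_le_add_right hle _)
      _ ≤ Λi i (X ω + Function.update r i t + Pi.single i c) :=
          le_add_single_of_selfPreferential hΛ hL hpref i hδ _ (Finset.notMem_erase _ _) _ h2
      _ = Λi i (X ω + Function.update r i (t + c)) := by rw [hupd, add_assoc]

/-- The best response map is a contraction for the sup norm with constant `L (N - 1)`. -/
theorem nash_capital_unique (hρ : IsCoherentRiskMeasure ρ) (hΛ : IsSingleAggregation Λ)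
    (hdec : IsSingleDecomposition Λ Λi) {L : ℝ} (hL : 0 ≤ L)
    (hpref : ∀ i j, i ≠ j → ∀ x ∈ effDom Λ, ∀ α : ℝ, 0 ≤ α →
      Λi i (x + Pi.single j α) ≤ Λi i (x + Pi.single i (L * α)))
    (hLN : L * ((N : ℝ) - 1) < 1) {X : Lp (Fin N → ℝ) ⊤ P} {r r' : Fin N → ℝ}
    (hr : ∀ i, IsGLB {t : ℝ | Function.update r i t ∈ feasibleCapital (sensitive Λ) X ∧
      IsAccepted (acceptanceSet ρ) (sensitive (Λi i)) X (Function.update r i t)} (r i))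
    (hr' : ∀ i, IsGLB {t : ℝ | Function.update r' i t ∈ feasibleCapital (sensitive Λ) X ∧
      IsAccepted (acceptanceSet ρ) (sensitive (Λi i)) X (Function.update r' i t)} (r' i)) :
    r = r' := by
  rcases isEmpty_or_nonempty (Fin N) with _ | _
  · exact Subsingleton.elim _ _
  obtain ⟨i, hi⟩ := Finite.exists_max fun i => |r i - r' i|
  have h1 := nash_capital_le_add hρ hΛ hdec hL hpref (hr i) (hr' i)
  have h2 := nash_capital_le_add hρ hΛ hdec hL hpref (hr' i) (hr i)
  simp only [abs_sub_comm (r' _)] at h2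
  have h3 : |r i - r' i| ≤ L * ∑ j ∈ Finset.univ.erase i, |r j - r' j| :=
    abs_le.2 ⟨by linarith, by linarith⟩
  have h4 : ∑ j ∈ Finset.univ.erase i, |r j - r' j| ≤ ((N : ℝ) - 1) * |r i - r' i| := by
    refine (Finset.sum_le_card_nsmul _ _ _ fun j _ => hi j).trans_eq ?_
    rw [Finset.card_erase_of_mem (Finset.mem_univ i), Finset.card_univ, Fintype.card_fin,
      nsmul_eq_mul, Nat.cast_pred (Fin.pos i)]
  have h5 : |r i - r' i| ≤ L * ((N : ℝ) - 1) * |r i - r' i| :=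
    h3.trans ((mul_le_mul_of_nonneg_left h4 hL).trans_eq (mul_assoc _ _ _).symm)
  have h6 : |r i - r' i| ≤ 0 := by nlinarith [abs_nonneg (r i - r' i)]
  ext j
  exact sub_eq_zero.1 (abs_nonpos_iff.1 ((hi j).trans h6))

end Nash

end SystemicRisk

open SystemicRisk
theorem mainTheorem4 {Ω : Type*} [MeasurableSpace Ω] (P : Measure Ω) [IsProbabilityMeasure P]
    (ρ : Lp ℝ ⊤ P → ℝ) (hρ : IsCoherentRiskMeasure ρ)
    (N : ℕ) (hN : 1 ≤ N)
    (Λ : (Fin N → ℝ) → WithBot ℝ) (hΛ : IsSingleAggregation Λ)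
    (Λi : Fin N → (Fin N → ℝ) → WithBot ℝ) (hdec : IsSingleDecomposition Λ Λi)
    (hfeas : ∃ xbar ∈ effDom Λ, ∀ x ∈ effDom Λ, ∀ i,
      0 < Λi i (Function.update x i (xbar i)))
    (hinfeas : ∃ xlow ∈ effDom Λ, ∀ x ∈ effDom Λ, ∀ i, ∀ ε : ℝ, 0 < ε →
      Λi i (Function.update x i (xlow i - ε)) < 0) :
    IsAggregation (sensitive Λ) ∧
    IsDecomposition (sensitive Λ) (fun i => sensitive (Λi i)) ∧
    shockDomain P (sensitive Λ) = Set.univ ∧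
    (∃ r : Lp (Fin N → ℝ) ⊤ P → (Fin N → ℝ),
      IsNashRule (acceptanceSet ρ) (sensitive Λ) (fun i => sensitive (Λi i)) (fun X => r X)) ∧
    (∀ L : ℝ, 0 ≤ L → L < 1 →
      (∀ i j, i ≠ j → ∀ x ∈ effDom Λ, ∀ α : ℝ, 0 ≤ α →
        Λi i (x + Pi.single j α) ≤ Λi i (x + Pi.single i (L * α))) →
      IsSelfPreferentialWith (sensitive Λ) (fun i => sensitive (Λi i)) L ∧
      (L * ((N : ℝ) - 1) < 1 →
        ∃! r : Lp (Fin N → ℝ) ⊤ P → (Fin N → ℝ),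
          IsNashRule (acceptanceSet ρ) (sensitive Λ) (fun i => sensitive (Λi i))
            (fun X => r X))) := by

  have hdom : shockDomain P (sensitive Λ) = Set.univ := shockDomain_sensitive_eq_univ hΛ
  have hex : ∃ r : Lp (Fin N → ℝ) ⊤ P → (Fin N → ℝ),
      IsNashRule (acceptanceSet ρ) (sensitive Λ) (fun i => sensitive (Λi i)) (fun X => r X) := by
    choose r hr using exists_nash_capital hρ hΛ hdec hfeas hinfeas
    exact ⟨r, fun X i => hr X.1 i⟩
  refine ⟨hΛ.isAggregation_sensitive, hdec.isDecomposition_sensitive hfeas hinfeas, hdom, hex,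
    fun L hL hL1 hpref => ⟨⟨hL, hL1, fun i j hij x m hxm δ hδ => ?_⟩, fun hLN => ?_⟩⟩
  · have := hpref i j hij (x + m) hxm δ hδ
    simpa only [sensitive, add_assoc] using this
  · obtain ⟨r, hr⟩ := hex
    refine ⟨r, hr, fun r' hr' => funext fun X => ?_⟩
    have hX : X ∈ shockDomain P (sensitive Λ) := hdom ▸ mem_univ X
    exact nash_capital_unique hρ hΛ hdec hL hpref hLN (hr' ⟨X, hX⟩) (hr ⟨X, hX⟩)
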